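/- **Theorem 4.5.** In the Euclidean plane let $z_0=(0,0)$, $z_1=(1,0)$, $z_2=(\tfrac12,\tfrac{\sqrt3}{2})$, let $f_i(x)=\tfrac12x+\tfrac12z_i$ for $i=0,1,2$, and let $s=\frac{\log 3}{\log 2}$, the similarity dimension of the Sierpinski gasket (the attractor of $\{f_0,f_1,f_2\}$). Let $\mu$ be the natural probability measure of the gasket, that is, the unique compactly supported Borel probability measure on $\mathbb R^2$ with $\mu=\mathbf M(\mu)$, where $\mathbf M(\alpha)=\frac13\sum_{i=0}^2\alpha\circ f_i^{-1}$. Put $A_1=\{z_0,z_1,z_2\}$, $\mu_1=\frac13(\delta_{z_0}+\delta_{z_1}+\delta_{z_2})$ and, for $k\ge2$, $A_k=F^{k-1}(A_1)$, where $F(A)=f_0(A)\cup f_1(A)\cup f_2(A)$, and $\mu_k=\mathbf M^{k-1}(\mu_1)$. Let $B(x,d)$ and $\mathring B(x,d)$ be the closed and the open Euclidean ball with centre $x$ and radius $d$. For a Borel measure $\alpha$ and $d>0$ let $$\theta^s_\alpha(x,d)=\frac{\alpha(B(x,d))}{(2d)^s},\qquad \mathring\theta^s_\alpha(x,d)=\frac{\alpha(\mathring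 B(x,d))}{(2d)^s},\qquad \underline\theta^s_\alpha(x)=\liminf_{d\to0^+}\theta^s_\alpha(x,d),\qquad \overline\theta^s_\alpha(x)=\limsup_{d\to0^+}\theta^s_\alpha(x,d).$$ For an integer $k>1$ let $R_k=\{|x-z_0| : x\in A_k\}\cap[\tfrac12-2^{-k},1]$ and $$\underline\xi_k=\min_{d\in R_k}\mathring\theta^s_{\mu_k}(z_0,d),\qquad \overline\xi_k=\max_{d\in R_k}\theta^s_{\mu_k}(z_0,d);$$ both extrema are attained. Let $d_k\in R_k$ be any radius with $\mathring\theta^s_{\mu_k}(z_0,d_k)=\underline\xi_k$ and let $D_k\in R_k$ be any radius with $\theta^s_{\mu_k}(z_0,D_k)=\overline\xi_k$. Then both $\underline\theta^s_\mu(z_0)$ and $\underline\xi_k$ lie in $$\left[(1-2^{1-k})^s\,\underline\xi_k,\ \frac{\mu_k(\mathring B(z_0,d_k+2^{-k}))}{(2d_k)^s}\right],$$ and both $\overline\theta^s_\mu(z_0)$ and $\overline\xi_k$ lie in $$\left[\frac{\mu_k(B(z_0,D_k-2^{-k}))}{(2D_k)^s},\ (1+2^{1-k})^s\,\overline\xi_k\right].$$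 -/

import Mathlib

open MeasureTheory Filter Topology
open scoped ENNReal

namespace SierpinskiGasket

/-- The Euclidean plane. -/
abbrev Plane : Type := EuclideanSpace ℝ (Fin 2)

/-- The vertices `z₀ = (0,0)`, `z₁ = (1,0)`, `z₂ = (1/2, √3/2)`. -/
noncomputable def vertex : Fin 3 → Plane :=
  ![!₂[0, 0], !₂[1, 0], !₂[1 / 2, Real.sqrt 3 / 2]]

/-- The similitudes `f₀, f₁, f₂` of ratio `1/2`; `sim i` has fixed point `vertex i`. -/
noncomputable def sim (i : Fin 3) (x : Plane) : Plane :=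
  (1 / 2 : ℝ) • x + (1 / 2 : ℝ) • vertex i

/-- The similarity dimension `s = log 3 / log 2` of the gasket. -/
noncomputable def simDim : ℝ := Real.log 3 / Real.log 2

/-- The Hutchinson operator `F(A) = f₀(A) ∪ f₁(A) ∪ f₂(A)`. -/
def hutchinson (A : Set Plane) : Set Plane := ⋃ i : Fin 3, sim i '' A

/-- The discrete sets `A₁ = {z₀, z₁, z₂}` and `A_k = F^{k-1}(A₁)`, for `k ≥ 1`. -/
def approxSet (k : ℕ) : Set Plane := hutchinson^[k - 1] (Set.range vertex)

/-- The Markov operator `M(α) = ∑ i, r_i^s • (α ∘ f_i⁻¹)`, with `r_i^s = (1/2)^s = 1/3`. -/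
noncomputable def markov (α : Measure Plane) : Measure Plane :=
  ∑ i : Fin 3, (3 : ℝ≥0∞)⁻¹ • α.map (sim i)

/-- The discrete measures `μ₁ = (δ_{z₀} + δ_{z₁} + δ_{z₂}) / 3` and `μ_k = M^{k-1}(μ₁)`,
for `k ≥ 1`. -/
noncomputable def discreteMeasure (k : ℕ) : Measure Plane :=
  markov^[k - 1] ((3 : ℝ≥0∞)⁻¹ • ∑ i : Fin 3, Measure.dirac (vertex i))

/-- `α` is a compactly supported Borel probability measure on the plane that is fixed by the
Markov operator. -/
structure IsInvariant (α : Measure Plane) : Prop where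
  isProbabilityMeasure : IsProbabilityMeasure α
  compactSupport : ∃ K : Set Plane, IsCompact K ∧ α Kᶜ = 0
  markov_eq : markov α = α

/-! The Markov operator has exactly one invariant measure. -/

theorem continuous_sim (i : Fin 3) : Continuous (sim i) := by
  unfold sim; fun_prop

theorem charFun_markov (α : Measure Plane) [IsProbabilityMeasure α] (t : Plane) :
    charFun (markov α) t =
      ∑ i : Fin 3, (3 : ℂ)⁻¹ *
        (charFun α ((1 / 2 : ℝ) • t) *
          Complex.exp (inner ℝ ((1 / 2 : ℝ) • vertex i) t * Complex.I)) := by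
  have hint : ∀ i : Fin 3, charFun (α.map (sim i)) t = charFun α ((1 / 2 : ℝ) • t) *
      Complex.exp (inner ℝ ((1 / 2 : ℝ) • vertex i) t * Complex.I) := by
    intro i
    have h : α.map (sim i)
        = (α.map (fun x => (1 / 2 : ℝ) • x)).map (fun x => x + (1 / 2 : ℝ) • vertex i) := by
      rw [Measure.map_map (by fun_prop) (by fun_prop)]; rfl
    rw [h, charFun_map_add_const, charFun_map_smul]
  simp only [← hint]
  simp only [charFun_apply, markov]
  rw [integral_finsetSum_measure]
  · refine Finset.sum_congr rfl fun i _ => ?_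
    rw [integral_smul_measure]
    simp [Complex.real_smul]
  · intro i _
    have : IsProbabilityMeasure (α.map (sim i)) :=
      Measure.isProbabilityMeasure_map (continuous_sim i).measurable.aemeasurable
    refine Integrable.smul_measure ?_ (by simp)
    refine Integrable.of_bound (C := 1) (by fun_prop) (ae_of_all _ fun x => ?_)
    rw [Complex.norm_exp_ofReal_mul_I]

theorem invariant_unique {α β : Measure Plane} (hα : IsInvariant α) (hβ : IsInvariant β) :
    α = β := by
  have := hα.isProbabilityMeasure
  have := hβ.isProbabilityMeasure
  refine Measure.ext_of_charFun (funext fun t => ?_)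
  have step : ∀ t : Plane, ‖charFun α t - charFun β t‖
      ≤ ‖charFun α ((1 / 2 : ℝ) • t) - charFun β ((1 / 2 : ℝ) • t)‖ := by
    intro t
    conv_lhs => rw [← hα.markov_eq, ← hβ.markov_eq]
    rw [charFun_markov, charFun_markov, ← Finset.sum_sub_distrib]
    refine (norm_sum_le _ _).trans ?_
    simp only [← mul_sub, ← sub_mul, norm_mul, Complex.norm_exp_ofReal_mul_I]
    simp
  have iter : ∀ n : ℕ, ‖charFun α t - charFun β t‖
      ≤ ‖charFun α ((1 / 2 : ℝ) ^ n • t) - charFun β ((1 / 2 : ℝ) ^ n • t)‖ := by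
    intro n
    induction n with
    | zero => simp
    | succ n ih =>
      refine ih.trans ((step _).trans (le_of_eq ?_))
      rw [smul_smul, pow_succ']
  have lim : Tendsto (fun n : ℕ => (1 / 2 : ℝ) ^ n • t) atTop (𝓝 0) := by
    have := (tendsto_pow_atTop_nhds_zero_of_lt_one (r := (1 / 2 : ℝ))
      (by norm_num) (by norm_num)).smul_const t
    simpa using this
  have cα : Continuous (charFun α) := continuous_charFun
  have cβ : Continuous (charFun β) := continuous_charFun
  have lim2 := (((cα.tendsto 0).comp lim).sub ((cβ.tendsto 0).comp lim)).norm
  have h0 := ge_of_tendsto' lim2 iter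
  rw [charFun_zero, charFun_zero] at h0
  simp at h0
  exact sub_eq_zero.mp h0

/-- The uniform measure on the alphabet. -/
noncomputable def letterMeasure : Measure (Fin 3) := ∑ i : Fin 3, (3 : ℝ≥0∞)⁻¹ • Measure.dirac i

instance : IsProbabilityMeasure letterMeasure where
  measure_univ := by
    simp only [letterMeasure, Measure.finsetSum_apply, Measure.smul_apply, measure_univ]
    simp [ENNReal.mul_inv_cancel]

/-- The uniform Bernoulli measure on the code space. -/
noncomputable def codeMeasure : Measure (ℕ → Fin 3) := Measure.infinitePi fun _ => letterMeasure

instance : IsProbabilityMeasure codeMeasure := by unfold codeMeasure; infer_instance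

/-- The word `i w₀ w₁ …`. -/
def cons (i : Fin 3) (w : ℕ → Fin 3) : ℕ → Fin 3 := fun n => Nat.casesOn n i w

theorem measurable_cons (i : Fin 3) : Measurable (cons i) := by
  refine measurable_pi_lambda _ fun n => ?_
  cases n with
  | zero => exact measurable_const
  | succ n => exact measurable_pi_apply n

theorem codeMeasure_eq : ∑ i : Fin 3, (3 : ℝ≥0∞)⁻¹ • codeMeasure.map (cons i) = codeMeasure := by
  classical
  refine Measure.eq_infinitePi _ fun S t ht => ?_
  obtain ⟨N, hN⟩ : ∃ N : ℕ, ∀ n ∈ S, n < N + 1 :=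
    ⟨S.sup id, fun n hn => Nat.lt_succ_of_le (Finset.le_sup (f := id) hn)⟩
  set t' : ℕ → Set (Fin 3) := fun n => if n ∈ S then t n else Set.univ with ht'
  have hbox : Set.pi (S : Set ℕ) t = Set.pi (Finset.range (N + 1) : Set ℕ) t' := by
    ext w
    simp only [Set.mem_pi, ht', Finset.mem_coe, Finset.mem_range]
    constructor
    · intro h n _
      by_cases hn : n ∈ S
      · simpa [hn] using h n hn
      · simp [hn]
    · intro h n hn
      simpa [hn] using h n (hN n hn)
  have hprod : ∏ n ∈ S, letterMeasure (t n)
      = ∏ n ∈ Finset.range (N + 1), letterMeasure (t' n) := by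
    rw [← Finset.prod_subset (s₁ := S) (fun n hn => Finset.mem_range.2 (hN n hn))]
    · exact Finset.prod_congr rfl fun n hn => by simp [ht', hn]
    · intro n _ hn
      simp [ht', hn]
  have hmeas : MeasurableSet (Set.pi (Finset.range (N + 1) : Set ℕ) t') :=
    MeasurableSet.pi (Set.to_countable _) fun n _ => MeasurableSet.of_discrete
  rw [hbox, hprod, Finset.prod_range_succ']
  have hpre : ∀ i : Fin 3, codeMeasure (cons i ⁻¹' Set.pi (Finset.range (N + 1) : Set ℕ) t')
      = (t' 0).indicator 1 i * ∏ n ∈ Finset.range N, letterMeasure (t' (n + 1)) := by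
    intro i
    by_cases hi : i ∈ t' 0
    · have : cons i ⁻¹' Set.pi (Finset.range (N + 1) : Set ℕ) t'
          = Set.pi (Finset.range N : Set ℕ) fun n => t' (n + 1) := by
        ext w
        simp only [Set.mem_preimage, Set.mem_pi, Finset.mem_coe, Finset.mem_range]
        constructor
        · intro h n hn
          exact h (n + 1) (by omega)
        · intro h n hn
          cases n with
          | zero => exact hi
          | succ n => exact h n (by omega)
      rw [this, codeMeasure, Measure.infinitePi_pi _ fun n _ => MeasurableSet.of_discrete]
      simp [hi]
    · have : cons i ⁻¹' Set.pi (Finset.range (N + 1) : Set ℕ) t' = ∅ := by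
        ext w
        simp only [Set.mem_preimage, Set.mem_pi, Finset.mem_coe, Finset.mem_range,
          Set.mem_empty_iff_false, iff_false]
        exact fun h => hi (h 0 (by omega))
      rw [this]
      simp [hi]
  simp only [Measure.finsetSum_apply, Measure.smul_apply,
    Measure.map_apply (measurable_cons _) hmeas, hpre, smul_eq_mul]
  rw [mul_comm (∏ n ∈ Finset.range N, letterMeasure (t' (n + 1)))]
  generalize (∏ n ∈ Finset.range N, letterMeasure (t' (n + 1))) = c
  simp only [letterMeasure, Measure.finsetSum_apply, Measure.smul_apply, smul_eq_mul,
    Finset.sum_mul, Measure.dirac_apply, mul_assoc]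

theorem norm_vertex_le (i : Fin 3) : ‖vertex i‖ ≤ 1 := by
  have h3 : (Real.sqrt 3) ^ 2 = 3 := Real.sq_sqrt (by norm_num)
  fin_cases i <;> simp [vertex, EuclideanSpace.norm_eq, Fin.sum_univ_two, div_pow]
  norm_num

/-- The coding map of the gasket. -/
noncomputable def code (w : ℕ → Fin 3) : Plane := ∑' n : ℕ, ((1 / 2 : ℝ) ^ (n + 1)) • vertex (w n)

theorem norm_term_le (n : ℕ) (w : ℕ → Fin 3) :
    ‖((1 / 2 : ℝ) ^ (n + 1)) • vertex (w n)‖ ≤ (1 / 2 : ℝ) / 2 ^ n := by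
  rw [norm_smul, Real.norm_of_nonneg (by positivity)]
  calc (1 / 2 : ℝ) ^ (n + 1) * ‖vertex (w n)‖ ≤ (1 / 2 : ℝ) ^ (n + 1) * 1 := by
        gcongr; exact norm_vertex_le _
    _ = (1 / 2 : ℝ) / 2 ^ n := by rw [pow_succ]; simp; ring

theorem summable_bound : Summable fun n : ℕ => (1 / 2 : ℝ) / 2 ^ n := by
  have := summable_geometric_two' (1 : ℝ)
  exact this

theorem continuous_code : Continuous code := by
  refine continuous_tsum (fun n => ?_) summable_bound norm_term_le
  have hz : Continuous vertex := continuous_of_discreteTopology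
  have hw : Continuous fun w : ℕ → Fin 3 => w n := continuous_apply n
  exact (hz.comp hw).const_smul ((1 / 2 : ℝ) ^ (n + 1))

theorem code_cons (i : Fin 3) (w : ℕ → Fin 3) : code (cons i w) = sim i (code w) := by
  have h : ∀ w : ℕ → Fin 3, Summable fun n : ℕ => ((1 / 2 : ℝ) ^ (n + 1)) • vertex (w n) := fun w =>
    Summable.of_norm_bounded summable_bound fun n => norm_term_le n w
  unfold code sim
  rw [(h _).tsum_eq_zero_add, add_comm, ← (h w).tsum_const_smul]
  congr 1
  · refine tsum_congr fun n => ?_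
    rw [smul_smul, ← pow_succ']
    rfl
  · simp [cons]

theorem isInvariant_map_code : IsInvariant (codeMeasure.map code) where
  isProbabilityMeasure :=
    Measure.isProbabilityMeasure_map continuous_code.measurable.aemeasurable
  compactSupport := by
    have hK : IsCompact (Set.range code) := isCompact_range continuous_code
    refine ⟨Set.range code, hK, ?_⟩
    rw [Measure.map_apply continuous_code.measurable hK.measurableSet.compl]
    simp
  markov_eq := by
    have hc : Measurable code := continuous_code.measurable
    conv_rhs => rw [← codeMeasure_eq]
    rw [markov, Measure.map_finset_sum hc.aemeasurable]
    refine Finset.sum_congr rfl fun i _ => ?_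
    rw [Measure.map_smul, Measure.map_map (continuous_sim i).measurable hc,
      Measure.map_map hc (measurable_cons i)]
    congr 2
    exact funext fun w => (code_cons i w).symm

theorem existsUnique_isInvariant : ∃! α : Measure Plane, IsInvariant α :=
  ⟨_, isInvariant_map_code, fun _ hβ => invariant_unique hβ isInvariant_map_code⟩

/-- The natural probability measure `μ` of the gasket: the unique compactly supported Borel
probability measure that is fixed by the Markov operator. -/
noncomputable def naturalMeasure : Measure Plane := existsUnique_isInvariant.choose

/-- The `t`-density `α(B(x,d)) / (2d)^t` of the closed ball `B(x,d)`, for `d > 0`. -/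
noncomputable def density (α : Measure Plane) (t : ℝ) (x : Plane) (d : ℝ) : ℝ≥0∞ :=
  α (Metric.closedBall x d) / ENNReal.ofReal ((2 * d) ^ t)

/-- The `t`-density of the open ball of centre `x` and radius `d`, for `d > 0`. -/
noncomputable def openDensity (α : Measure Plane) (t : ℝ) (x : Plane) (d : ℝ) : ℝ≥0∞ :=
  α (Metric.ball x d) / ENNReal.ofReal ((2 * d) ^ t)

/-- The lower spherical `t`-density of `α` at `x`. -/
noncomputable def lowerDensity (α : Measure Plane) (t : ℝ) (x : Plane) : ℝ≥0∞ :=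
  liminf (fun d : ℝ => density α t x d) (𝓝[>] 0)

/-- The upper spherical `t`-density of `α` at `x`. -/
noncomputable def upperDensity (α : Measure Plane) (t : ℝ) (x : Plane) : ℝ≥0∞ :=
  limsup (fun d : ℝ => density α t x d) (𝓝[>] 0)

/-- The radii `d = |x - z₀|` with `x ∈ A_k` and `d ∈ [1/2 - 2^{-k}, 1]`. -/
def radii (k : ℕ) : Set ℝ :=
  {d | (∃ x ∈ approxSet k, d = dist x (vertex 0)) ∧ d ∈ Set.Icc (1 / 2 - (2 : ℝ) ^ (-(k : ℤ))) 1}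

/-- The smallest `μ_k`-density of an open ball centred at `z₀` with radius in `radii k`. -/
noncomputable def lowerEstimate (k : ℕ) : ℝ≥0∞ :=
  sInf (openDensity (discreteMeasure k) simDim (vertex 0) '' radii k)

/-- The largest `μ_k`-density of a closed ball centred at `z₀` with radius in `radii k`. -/
noncomputable def upperEstimate (k : ℕ) : ℝ≥0∞ :=
  sSup (density (discreteMeasure k) simDim (vertex 0) '' radii k)

end SierpinskiGasket

open SierpinskiGasket

/-!
Both `μ` and `μ_k` are laws of random points of the gasket on the same code space: `μ` is the law
of the point with code `w`, and `μ_k` that of the point whose code repeats the `k`-th letter of `w`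
forever. These two points are at distance at most `2^{-k}`, so each measure of a ball of radius `r`
is controlled by the other measure of the ball of radius `r ± 2^{-k}`.

On the other hand `μ` is exactly self-similar at a vertex, since the two other cells stay at
distance at least `1/2` from it: its density there is the same at `r` and at `2r` as long as
`r < 1/2`. The lower and upper densities are therefore governed by the radii in `[1/2, 1)`, where
an error of `2^{-k}` in the radius costs at most a factor `(1 ± 2^{1-k})^s`; and each of the
finitely supported measures `μ_k` sees a radius only through a nearby element of `R_k`.
-/

namespace SierpinskiGasket

section Coupling

variable {Ω X : Type*} [MeasurableSpace Ω] [PseudoMetricSpace X] [MeasurableSpace X]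
  [OpensMeasurableSpace X] {P : Measure Ω} {f g : Ω → X} {ε : ℝ}

lemma map_closedBall_le_of_dist_le (hf : AEMeasurable f P) (hg : AEMeasurable g P)
    (hfg : ∀ᵐ ω ∂P, dist (f ω) (g ω) ≤ ε) (x : X) (r : ℝ) :
    P.map f (Metric.closedBall x r) ≤ P.map g (Metric.closedBall x (r + ε)) := by
  rw [Measure.map_apply_of_aemeasurable hf measurableSet_closedBall,
    Measure.map_apply_of_aemeasurable hg measurableSet_closedBall]
  refine measure_mono_ae ?_
  filter_upwards [hfg] with ω hω (hr : dist (f ω) x ≤ r)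
  exact (dist_triangle_left (g ω) x (f ω)).trans (by linarith)

lemma map_ball_le_of_dist_le (hf : AEMeasurable f P) (hg : AEMeasurable g P)
    (hfg : ∀ᵐ ω ∂P, dist (f ω) (g ω) ≤ ε) (x : X) (r : ℝ) :
    P.map f (Metric.ball x r) ≤ P.map g (Metric.ball x (r + ε)) := by
  rw [Measure.map_apply_of_aemeasurable hf measurableSet_ball,
    Measure.map_apply_of_aemeasurable hg measurableSet_ball]
  refine measure_mono_ae ?_
  filter_upwards [hfg] with ω hω (hr : dist (f ω) x < r)
  exact (dist_triangle_left (g ω) x (f ω)).trans_lt (by linarith)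

end Coupling

section FiniteSupport

variable {X : Type*} [PseudoMetricSpace X] [MeasurableSpace X] {α : Measure X} {A : Set X}
  {x z : X} {r : ℝ}

lemma exists_ball_le_closedBall_of_finite (hA : A.Finite) (hα : ∀ᵐ y ∂α, y ∈ A) (hx : x ∈ A)
    (hr : r < dist x z) :
    ∃ y ∈ A, dist y z ∈ Set.Ioc r (dist x z) ∧
      α (Metric.ball z (dist y z)) ≤ α (Metric.closedBall z r) := by
  obtain ⟨y, ⟨hyA, hy⟩, hmin⟩ := Set.exists_min_image {y ∈ A | r < dist y z} (dist · z)
    (hA.sep _) ⟨x, hx, hr⟩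
  refine ⟨y, hyA, ⟨hy, hmin x ⟨hx, hr⟩⟩, measure_mono_ae ?_⟩
  filter_upwards [hα] with p hpA (hp : dist p z < dist y z)
  by_contra hpr
  exact hp.not_ge (hmin p ⟨hpA, not_le.1 hpr⟩)

lemma exists_closedBall_le_closedBall_of_finite (hA : A.Finite) (hα : ∀ᵐ y ∂α, y ∈ A)
    (hx : x ∈ A) (hr : dist x z ≤ r) :
    ∃ y ∈ A, dist y z ∈ Set.Icc (dist x z) r ∧
      α (Metric.closedBall z r) ≤ α (Metric.closedBall z (dist y z)) := by
  obtain ⟨y, ⟨hyA, hy⟩, hmax⟩ := Set.exists_max_image {y ∈ A | dist y z ≤ r} (dist · z)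
    (hA.sep _) ⟨x, hx, hr⟩
  refine ⟨y, hyA, ⟨hmax x ⟨hx, hr⟩, hy⟩, measure_mono_ae ?_⟩
  filter_upwards [hα] with p hpA hp
  exact hmax p ⟨hpA, hp⟩

end FiniteSupport

section Dyadic

variable {β : Type*} {f : ℝ → β} {a r : ℝ}

lemma exists_eq_mul_half_pow (hr : r ∈ Set.Ioo 0 a) :
    ∃ d ∈ Set.Ico (a / 2) a, ∃ n : ℕ, r = d * (1 / 2) ^ n := by
  have hex : ∃ n : ℕ, a / 2 ≤ r * 2 ^ n := by
    obtain ⟨n, hn⟩ := pow_unbounded_of_one_lt (a / 2 / r) one_lt_two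
    exact ⟨n, ((div_lt_iff₀' hr.1).1 hn).le⟩
  refine ⟨r * 2 ^ Nat.find hex, ⟨Nat.find_spec hex, ?_⟩, Nat.find hex, ?_⟩
  · cases hn : Nat.find hex with
    | zero => simpa using hr.2
    | succ n =>
      have hlt : r * 2 ^ n < a / 2 := not_le.1 (Nat.find_min hex (hn ▸ n.lt_succ_self))
      rw [pow_succ]
      linarith
  · rw [mul_assoc, ← mul_pow, mul_one_div_cancel two_ne_zero, one_pow, mul_one]

lemma le_comp_mul_half_pow [Preorder β] (hf : ∀ r ∈ Set.Ioo 0 (a / 2), f (2 * r) ≤ f r)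
    (hr : r ∈ Set.Ioo 0 a) (n : ℕ) : f r ≤ f (r * (1 / 2) ^ n) := by
  induction n with
  | zero => simp
  | succ n ih =>
    obtain ⟨hr0, hra⟩ := hr
    have hpow : (1 / 2 : ℝ) ^ n ≤ 1 := pow_le_one₀ (by norm_num) (by norm_num)
    have hmem : r * (1 / 2) ^ (n + 1) ∈ Set.Ioo 0 (a / 2) := by
      refine ⟨by positivity, ?_⟩
      rw [pow_succ]
      nlinarith
    calc f r ≤ f (r * (1 / 2) ^ n) := ih
      _ = f (2 * (r * (1 / 2) ^ (n + 1))) := by ring_nf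
      _ ≤ f (r * (1 / 2) ^ (n + 1)) := hf _ hmem

lemma tendsto_mul_half_pow_nhdsGT_zero (hr : 0 < r) :
    Tendsto (fun n : ℕ => r * (1 / 2 : ℝ) ^ n) atTop (𝓝[>] 0) := by
  refine tendsto_nhdsWithin_iff.2 ⟨?_, .of_forall fun n => Set.mem_Ioi.2 (by positivity)⟩
  simpa using (tendsto_pow_atTop_nhds_zero_of_lt_one (r := (1 / 2 : ℝ))
    (by norm_num) (by norm_num)).const_mul r

variable [CompleteLinearOrder β] {c : β}

lemma le_limsup_of_two_mul_le (hf : ∀ r ∈ Set.Ioo 0 (a / 2), f (2 * r) ≤ f r)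
    (hr : r ∈ Set.Ioo 0 a) : f r ≤ limsup f (𝓝[>] 0) :=
  le_limsup_of_frequently_le <| (tendsto_mul_half_pow_nhdsGT_zero hr.1).frequently <|
    .of_forall <| le_comp_mul_half_pow hf hr

lemma le_liminf_of_two_mul_le (ha : 0 < a) (hf : ∀ r ∈ Set.Ioo 0 (a / 2), f (2 * r) ≤ f r)
    (hc : ∀ r ∈ Set.Ico (a / 2) a, c ≤ f r) : c ≤ liminf f (𝓝[>] 0) := by
  refine le_liminf_of_le (by isBoundedDefault) ?_
  filter_upwards [Ioo_mem_nhdsGT ha] with r hr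
  obtain ⟨d, hd, n, rfl⟩ := exists_eq_mul_half_pow hr
  exact (hc d hd).trans (le_comp_mul_half_pow hf ⟨(half_pos ha).trans_le hd.1, hd.2⟩ n)

lemma liminf_le_of_le_two_mul (hf : ∀ r ∈ Set.Ioo 0 (a / 2), f r ≤ f (2 * r))
    (hr : r ∈ Set.Ioo 0 a) : liminf f (𝓝[>] 0) ≤ f r :=
  le_limsup_of_two_mul_le (β := βᵒᵈ) hf hr

lemma limsup_le_of_le_two_mul (ha : 0 < a) (hf : ∀ r ∈ Set.Ioo 0 (a / 2), f r ≤ f (2 * r))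
    (hc : ∀ r ∈ Set.Ico (a / 2) a, f r ≤ c) : limsup f (𝓝[>] 0) ≤ c :=
  le_liminf_of_two_mul_le (β := βᵒᵈ) ha hf hc

end Dyadic

section RpowDiv

variable {t r x y : ℝ}

lemma div_ofReal_rpow (m : ℝ≥0∞) (hx : 0 < x) :
    m / ENNReal.ofReal (x ^ t) = ENNReal.ofReal (x⁻¹ ^ t) * m := by
  rw [ENNReal.div_eq_inv_mul, ← ENNReal.ofReal_inv_of_pos (Real.rpow_pos_of_pos hx t),
    Real.inv_rpow hx.le]

lemma ofReal_rpow_mul_div (m : ℝ≥0∞) (hr : 0 ≤ r) (hy : 0 < y) :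
    ENNReal.ofReal (r ^ t) * (m / ENNReal.ofReal (y ^ t)) = ENNReal.ofReal ((r / y) ^ t) * m := by
  rw [div_ofReal_rpow m hy, ← mul_assoc, ← ENNReal.ofReal_mul (Real.rpow_nonneg hr t),
    ← Real.mul_rpow hr (inv_nonneg.2 hy.le), div_eq_mul_inv]

lemma ofReal_rpow_mul_div_le (m : ℝ≥0∞) (ht : 0 ≤ t) (hr : 0 ≤ r) (hx : 0 < x) (hy : 0 < y)
    (hrx : r * x ≤ y) :
    ENNReal.ofReal (r ^ t) * (m / ENNReal.ofReal (y ^ t)) ≤ m / ENNReal.ofReal (x ^ t) := by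
  rw [ofReal_rpow_mul_div m hr hy, div_ofReal_rpow m hx]
  gcongr
  rwa [div_le_iff₀ hy, inv_mul_eq_div, le_div_iff₀ hx]

lemma div_le_ofReal_rpow_mul_div (m : ℝ≥0∞) (ht : 0 ≤ t) (hr : 0 ≤ r) (hx : 0 < x) (hy : 0 < y)
    (hrx : y ≤ r * x) :
    m / ENNReal.ofReal (x ^ t) ≤ ENNReal.ofReal (r ^ t) * (m / ENNReal.ofReal (y ^ t)) := by
  rw [ofReal_rpow_mul_div m hr hy, div_ofReal_rpow m hx]
  gcongr
  rwa [le_div_iff₀ hy, inv_mul_eq_div, div_le_iff₀ hx]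

end RpowDiv

/-! ### The geometry of the cells -/

lemma dist_vertex {i j : Fin 3} (hij : i ≠ j) : dist (vertex i) (vertex j) = 1 := by
  have h3 : Real.sqrt 3 ^ 2 = 3 := Real.sq_sqrt (by norm_num)
  rw [EuclideanSpace.dist_eq, Real.sqrt_eq_one, Fin.sum_univ_two]
  simp only [Real.dist_eq, sq_abs]
  fin_cases i <;> fin_cases j <;> simp [vertex] at hij ⊢ <;> linarith

lemma dist_vertex_le (i j : Fin 3) : dist (vertex i) (vertex j) ≤ 1 := by
  rcases eq_or_ne i j with rfl | hij
  · simp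
  · exact (dist_vertex hij).le

lemma inner_vertex_sub_nonneg (i j l : Fin 3) :
    0 ≤ inner ℝ (vertex j - vertex i) (vertex l - vertex i) := by
  rcases eq_or_ne j i with rfl | hji
  · simp
  rcases eq_or_ne l i with rfl | hli
  · simp
  have hjl := norm_sub_sq_real (vertex j - vertex i) (vertex l - vertex i)
  rw [sub_sub_sub_cancel_right, ← dist_eq_norm, ← dist_eq_norm, ← dist_eq_norm, dist_vertex hji,
    dist_vertex hli] at hjl
  nlinarith [dist_vertex_le j l, dist_nonneg (x := vertex j) (y := vertex l)]

lemma sim_vertex (i : Fin 3) : sim i (vertex i) = vertex i := by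
  unfold sim
  module

lemma dist_sim (i : Fin 3) (x y : Plane) : dist (sim i x) (sim i y) = 1 / 2 * dist x y := by
  rw [sim, sim, dist_add_right, dist_smul₀, Real.norm_of_nonneg (by norm_num)]

lemma sim_preimage_closedBall (i : Fin 3) (r : ℝ) :
    sim i ⁻¹' Metric.closedBall (vertex i) r = Metric.closedBall (vertex i) (2 * r) := by
  ext x
  rw [Set.mem_preimage, Metric.mem_closedBall, Metric.mem_closedBall]
  conv_lhs => rw [← sim_vertex i, dist_sim]
  constructor <;> intro h <;> linarith

lemma cons_tail (w : ℕ → Fin 3) : cons (w 0) (fun n => w (n + 1)) = w := by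
  funext n
  cases n <;> rfl

lemma hasSum_code (w : ℕ → Fin 3) :
    HasSum (fun n : ℕ => (1 / 2 : ℝ) ^ (n + 1) • vertex (w n)) (code w) :=
  (Summable.of_norm_bounded summable_bound fun n => norm_term_le n w).hasSum

lemma hasSum_code_sub (v w : ℕ → Fin 3) :
    HasSum (fun n : ℕ => (1 / 2 : ℝ) ^ (n + 1) • (vertex (v n) - vertex (w n)))
      (code v - code w) := by
  simpa only [smul_sub] using (hasSum_code v).sub (hasSum_code w)

lemma code_const (i : Fin 3) : code (fun _ => i) = vertex i := by
  have hfix : sim i (code fun _ => i) = code fun _ => i := by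
    rw [← code_cons]
    congr 1
    exact cons_tail fun _ => i
  have hdist := dist_sim i (code fun _ => i) (vertex i)
  rw [hfix, sim_vertex] at hdist
  exact dist_le_zero.1 (by linarith)

lemma dist_code_le_one (v w : ℕ → Fin 3) : dist (code v) (code w) ≤ 1 := by
  rw [dist_eq_norm]
  refine (hasSum_code_sub v w).norm_le_of_bounded (hasSum_geometric_two' 1) fun n => ?_
  calc ‖(1 / 2 : ℝ) ^ (n + 1) • (vertex (v n) - vertex (w n))‖
      = (1 / 2 : ℝ) ^ (n + 1) * dist (vertex (v n)) (vertex (w n)) := by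
        rw [norm_smul, Real.norm_of_nonneg (by positivity), dist_eq_norm]
    _ ≤ (1 / 2 : ℝ) ^ (n + 1) * 1 := by
        gcongr
        exact dist_vertex_le _ _
    _ = 1 / 2 / 2 ^ n := by
        rw [mul_one, pow_succ', one_div_pow, mul_one_div]

lemma dist_code_le {n : ℕ} {v w : ℕ → Fin 3} (hvw : ∀ m < n, v m = w m) :
    dist (code v) (code w) ≤ (1 / 2) ^ n := by
  induction n generalizing v w with
  | zero => simpa using dist_code_le_one v w
  | succ n ih =>
    rw [← cons_tail v, ← cons_tail w, code_cons, code_cons, hvw 0 n.succ_pos, dist_sim, pow_succ']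
    gcongr
    exact ih fun m hm => hvw (m + 1) (Nat.succ_lt_succ hm)

lemma inner_code_sub_vertex_nonneg (i j : Fin 3) (w : ℕ → Fin 3) :
    0 ≤ inner ℝ (vertex j - vertex i) (code w - vertex i) := by
  rw [← code_const i]
  refine ((hasSum_code_sub w fun _ => i).mapL (innerSL ℝ (vertex j - code fun _ => i))).nonneg
    fun n => ?_
  rw [code_const, innerSL_apply_apply, inner_smul_right]
  exact mul_nonneg (by positivity) (inner_vertex_sub_nonneg i j (w n))

lemma half_le_dist_sim_code {i j : Fin 3} (hij : j ≠ i) (w : ℕ → Fin 3) :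
    1 / 2 ≤ dist (sim j (code w)) (vertex i) := by
  set u := vertex j - vertex i with hu
  have hu1 : ‖u‖ = 1 := by rw [hu, ← dist_eq_norm, dist_vertex hij]
  have hsplit : sim j (code w) - vertex i
      = (1 / 2 : ℝ) • (code w - vertex i) + (1 / 2 : ℝ) • u := by
    rw [hu, sim]
    module
  calc (1 / 2 : ℝ) ≤ 1 / 2 * inner ℝ u (code w - vertex i) + 1 / 2 := by
        linarith [inner_code_sub_vertex_nonneg i j w]
    _ = inner ℝ u (sim j (code w) - vertex i) := by
        rw [hsplit, inner_add_right, inner_smul_right, inner_smul_right,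
          real_inner_self_eq_norm_sq, hu1, one_pow, mul_one]
    _ ≤ ‖u‖ * ‖sim j (code w) - vertex i‖ := real_inner_le_norm _ _
    _ = dist (sim j (code w)) (vertex i) := by rw [hu1, one_mul, dist_eq_norm]

/-! ### The natural and the discrete measures as laws on the code space -/

/-- The point of the gasket whose code is `w₀ w₁ … wₙ wₙ wₙ …`, that is,
`f_{w₀} ∘ ⋯ ∘ f_{w_{n-1}} (z_{wₙ})`. As `w` varies it runs through `A_{n+1}`. -/
noncomputable def approxCode (n : ℕ) (w : ℕ → Fin 3) : Plane := code fun m => w (min m n)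

lemma measurable_approxCode (n : ℕ) : Measurable (approxCode n) :=
  continuous_code.measurable.comp (measurable_pi_lambda _ fun m => measurable_pi_apply (min m n))

lemma approxCode_const (n : ℕ) (i : Fin 3) : approxCode n (fun _ => i) = vertex i :=
  code_const i

lemma approxCode_zero (w : ℕ → Fin 3) : approxCode 0 w = vertex (w 0) := by
  simp only [approxCode, Nat.min_zero, code_const]

lemma approxCode_succ_cons (n : ℕ) (i : Fin 3) (w : ℕ → Fin 3) :
    approxCode (n + 1) (cons i w) = sim i (approxCode n w) := by
  rw [approxCode, approxCode, ← code_cons]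
  congr 1
  funext m
  cases m with
  | zero => rfl
  | succ m => rw [Nat.add_min_add_right]; rfl

lemma dist_code_approxCode_le (k : ℕ) (w : ℕ → Fin 3) :
    dist (code w) (approxCode (k - 1) w) ≤ (2 : ℝ) ^ (-(k : ℤ)) := by
  rw [zpow_neg, zpow_natCast, ← inv_pow, ← one_div]
  exact dist_code_le fun m hm => by rw [min_eq_left (Nat.le_sub_one_of_lt hm)]

lemma map_codeMeasure_eq_sum {f : (ℕ → Fin 3) → Plane} (hf : Measurable f) :
    codeMeasure.map f = ∑ i : Fin 3, (3 : ℝ≥0∞)⁻¹ • codeMeasure.map fun w => f (cons i w) := by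
  conv_lhs => rw [← codeMeasure_eq, Measure.map_finset_sum hf.aemeasurable]
  refine Finset.sum_congr rfl fun i _ => ?_
  rw [Measure.map_smul, Measure.map_map hf (measurable_cons i), Function.comp_def]

lemma markov_map_codeMeasure {f g : (ℕ → Fin 3) → Plane} (hf : Measurable f) (hg : Measurable g)
    (hfg : ∀ i w, g (cons i w) = sim i (f w)) :
    markov (codeMeasure.map f) = codeMeasure.map g := by
  simp only [map_codeMeasure_eq_sum hg, hfg, markov,
    Measure.map_map (continuous_sim _).measurable hf, Function.comp_def]

lemma discreteMeasure_eq_map (k : ℕ) :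
    discreteMeasure k = codeMeasure.map (approxCode (k - 1)) := by
  unfold discreteMeasure
  induction k - 1 with
  | zero =>
    have hcons (i : Fin 3) : (fun w => approxCode 0 (cons i w)) = fun _ => vertex i :=
      funext fun w => approxCode_zero (cons i w)
    simp only [map_codeMeasure_eq_sum (measurable_approxCode 0), hcons, Measure.map_const,
      measure_univ, one_smul, Function.iterate_zero, id, Finset.smul_sum]
  | succ n ih =>
    rw [Function.iterate_succ_apply', ih]
    exact markov_map_codeMeasure (measurable_approxCode n) (measurable_approxCode (n + 1))
      (approxCode_succ_cons n)

lemma hutchinson_range {f g : (ℕ → Fin 3) → Plane} (hfg : ∀ i w, g (cons i w) = sim i (f w)) :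
    hutchinson (Set.range f) = Set.range g := by
  ext x
  simp only [hutchinson, Set.mem_iUnion]
  constructor
  · rintro ⟨i, _, ⟨w, rfl⟩, rfl⟩
    exact ⟨cons i w, hfg i w⟩
  · rintro ⟨w, rfl⟩
    exact ⟨w 0, _, ⟨fun n => w (n + 1), rfl⟩, by rw [← hfg, cons_tail]⟩

lemma approxSet_eq_range (k : ℕ) : approxSet k = Set.range (approxCode (k - 1)) := by
  unfold approxSet
  induction k - 1 with
  | zero =>
    refine Set.Subset.antisymm ?_ ?_
    · rintro _ ⟨i, rfl⟩
      exact ⟨fun _ => i, approxCode_const 0 i⟩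
    · rintro _ ⟨w, rfl⟩
      exact ⟨w 0, (approxCode_zero w).symm⟩
  | succ n ih =>
    rw [Function.iterate_succ_apply', ih, hutchinson_range (approxCode_succ_cons n)]

lemma finite_approxSet (k : ℕ) : (approxSet k).Finite := by
  unfold approxSet
  induction k - 1 with
  | zero => exact Set.finite_range _
  | succ n ih =>
    rw [Function.iterate_succ_apply']
    exact Set.finite_iUnion fun i => ih.image _

lemma ae_discreteMeasure_mem_approxSet (k : ℕ) : ∀ᵐ x ∂discreteMeasure k, x ∈ approxSet k := by
  have hmeas := (finite_approxSet k).measurableSet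
  rw [approxSet_eq_range] at hmeas ⊢
  rw [discreteMeasure_eq_map]
  exact ae_map_mem_range _ hmeas _

lemma isInvariant_naturalMeasure : IsInvariant naturalMeasure :=
  existsUnique_isInvariant.choose_spec.1

lemma naturalMeasure_eq_map : naturalMeasure = codeMeasure.map code :=
  invariant_unique isInvariant_naturalMeasure isInvariant_map_code

lemma ae_naturalMeasure_mem_range_code : ∀ᵐ x ∂naturalMeasure, x ∈ Set.range code := by
  rw [naturalMeasure_eq_map]
  exact ae_map_mem_range _ (isCompact_range continuous_code).measurableSet _

section Comparison

variable (k : ℕ) (x : Plane) (r : ℝ)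

lemma naturalMeasure_ball_le :
    naturalMeasure (Metric.ball x r)
      ≤ discreteMeasure k (Metric.ball x (r + (2 : ℝ) ^ (-(k : ℤ)))) := by
  rw [naturalMeasure_eq_map, discreteMeasure_eq_map]
  exact map_ball_le_of_dist_le continuous_code.aemeasurable (measurable_approxCode _).aemeasurable
    (.of_forall (dist_code_approxCode_le k)) x r

lemma naturalMeasure_closedBall_le :
    naturalMeasure (Metric.closedBall x r)
      ≤ discreteMeasure k (Metric.closedBall x (r + (2 : ℝ) ^ (-(k : ℤ)))) := by
  rw [naturalMeasure_eq_map, discreteMeasure_eq_map]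
  exact map_closedBall_le_of_dist_le continuous_code.aemeasurable
    (measurable_approxCode _).aemeasurable (.of_forall (dist_code_approxCode_le k)) x r

lemma discreteMeasure_closedBall_sub_le :
    discreteMeasure k (Metric.closedBall x (r - (2 : ℝ) ^ (-(k : ℤ))))
      ≤ naturalMeasure (Metric.closedBall x r) := by
  have hdist (w : ℕ → Fin 3) : dist (approxCode (k - 1) w) (code w) ≤ (2 : ℝ) ^ (-(k : ℤ)) :=
    (dist_comm _ _).trans_le (dist_code_approxCode_le k w)
  rw [naturalMeasure_eq_map, discreteMeasure_eq_map]
  simpa only [sub_add_cancel] using map_closedBall_le_of_dist_le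
    (measurable_approxCode _).aemeasurable continuous_code.aemeasurable (.of_forall hdist) x
    (r - (2 : ℝ) ^ (-(k : ℤ)))

end Comparison

/-! ### Self-similarity of the density at a vertex -/

lemma simDim_pos : 0 < simDim := div_pos (Real.log_pos (by norm_num)) (Real.log_pos (by norm_num))

lemma two_rpow_simDim : (2 : ℝ) ^ simDim = 3 :=
  Real.rpow_logb two_pos (by norm_num) three_pos

lemma markov_apply (α : Measure Plane) {S : Set Plane} (hS : MeasurableSet S) :
    markov α S = ∑ i : Fin 3, (3 : ℝ≥0∞)⁻¹ * α (sim i ⁻¹' S) := by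
  simp only [markov, Measure.finsetSum_apply, Measure.smul_apply, smul_eq_mul,
    Measure.map_apply (continuous_sim _).measurable hS]

lemma density_two_mul (α : Measure Plane) (x : Plane) {r : ℝ} (hr : 0 < r) :
    density α simDim x (2 * r)
      = (3 : ℝ≥0∞)⁻¹ * α (Metric.closedBall x (2 * r)) / ENNReal.ofReal ((2 * r) ^ simDim) := by
  rw [density, Real.mul_rpow (by norm_num) (by positivity : 0 ≤ 2 * r), two_rpow_simDim,
    ENNReal.ofReal_mul (by norm_num), ENNReal.ofReal_ofNat, ENNReal.div_eq_inv_mul,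
    ENNReal.div_eq_inv_mul, ENNReal.mul_inv (by simp) (by simp)]
  ring

lemma density_two_mul_le {α : Measure Plane} (hα : markov α = α) (i : Fin 3) {r : ℝ}
    (hr : 0 < r) :
    density α simDim (vertex i) (2 * r) ≤ density α simDim (vertex i) r := by
  rw [density_two_mul α _ hr, density]
  gcongr
  conv_rhs => rw [← hα, markov_apply α measurableSet_closedBall]
  rw [← sim_preimage_closedBall]
  exact Finset.single_le_sum
    (f := fun j => (3 : ℝ≥0∞)⁻¹ * α (sim j ⁻¹' Metric.closedBall (vertex i) r))
    (fun _ _ => zero_le) (Finset.mem_univ i)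

lemma naturalMeasure_sim_preimage_closedBall {i j : Fin 3} (hij : j ≠ i) {r : ℝ}
    (hr : r < 1 / 2) : naturalMeasure (sim j ⁻¹' Metric.closedBall (vertex i) r) = 0 := by
  rw [measure_eq_zero_iff_ae_notMem]
  filter_upwards [ae_naturalMeasure_mem_range_code]
  rintro _ ⟨w, rfl⟩ hw
  exact hr.not_ge ((half_le_dist_sim_code hij w).trans hw)

lemma naturalMeasure_closedBall_vertex (i : Fin 3) {r : ℝ} (hr : r < 1 / 2) :
    naturalMeasure (Metric.closedBall (vertex i) r)
      = (3 : ℝ≥0∞)⁻¹ * naturalMeasure (Metric.closedBall (vertex i) (2 * r)) := by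
  conv_lhs => rw [← isInvariant_naturalMeasure.markov_eq]
  rw [markov_apply _ measurableSet_closedBall, ← sim_preimage_closedBall]
  refine Finset.sum_eq_single_of_mem i (Finset.mem_univ i) fun j _ hj => ?_
  rw [naturalMeasure_sim_preimage_closedBall hj hr, mul_zero]

lemma density_naturalMeasure_two_mul (i : Fin 3) {r : ℝ} (hr : r ∈ Set.Ioo 0 (1 / 2)) :
    density naturalMeasure simDim (vertex i) (2 * r)
      = density naturalMeasure simDim (vertex i) r := by
  rw [density_two_mul _ _ hr.1, density, naturalMeasure_closedBall_vertex i hr.2]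

lemma le_lowerDensity {c : ℝ≥0∞} (i : Fin 3)
    (hc : ∀ d ∈ Set.Ico (1 / 2) 1, c ≤ density naturalMeasure simDim (vertex i) d) :
    c ≤ lowerDensity naturalMeasure simDim (vertex i) :=
  le_liminf_of_two_mul_le one_pos (fun _ hr => (density_naturalMeasure_two_mul i hr).le) hc

lemma upperDensity_le {c : ℝ≥0∞} (i : Fin 3)
    (hc : ∀ d ∈ Set.Ico (1 / 2) 1, density naturalMeasure simDim (vertex i) d ≤ c) :
    upperDensity naturalMeasure simDim (vertex i) ≤ c :=
  limsup_le_of_le_two_mul one_pos (fun _ hr => (density_naturalMeasure_two_mul i hr).ge) hc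

lemma density_le_upperDensity {α : Measure Plane} (hα : markov α = α) (i : Fin 3) {r : ℝ}
    (hr : 0 < r) :
    density α simDim (vertex i) r ≤ upperDensity α simDim (vertex i) :=
  le_limsup_of_two_mul_le (a := r + 1) (fun _ hd => density_two_mul_le hα i hd.1)
    ⟨hr, lt_add_one r⟩

lemma lowerDensity_le_density (i : Fin 3) {r : ℝ} (hr : r ∈ Set.Ioo 0 1) :
    lowerDensity naturalMeasure simDim (vertex i) ≤ density naturalMeasure simDim (vertex i) r :=
  liminf_le_of_le_two_mul (fun _ hd => (density_naturalMeasure_two_mul i hd).ge) hr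

lemma le_openDensity_of_forall_lt {α : Measure Plane} {t : ℝ} {x : Plane} {r : ℝ} {c : ℝ≥0∞}
    (hr : 0 < r) (hc : ∀ d ∈ Set.Ioo 0 r, c ≤ density α t x d) : c ≤ openDensity α t x r := by
  have hlim : Tendsto (fun d : ℝ => α (Metric.ball x r) / ENNReal.ofReal ((2 * d) ^ t)) (𝓝[<] r)
      (𝓝 (openDensity α t x r)) := by
    refine Tendsto.mono_left (ENNReal.Tendsto.const_div (ENNReal.tendsto_ofReal ?_)
      (.inl ENNReal.ofReal_ne_top)) nhdsWithin_le_nhds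
    exact (tendsto_const_nhds.mul tendsto_id).rpow_const (.inl (mul_pos two_pos hr).ne')
  refine ge_of_tendsto hlim ?_
  filter_upwards [Ioo_mem_nhdsLT hr] with d hd
  exact (hc d hd).trans (ENNReal.div_le_div_right
    (measure_mono (Metric.closedBall_subset_ball hd.2)) _)

lemma lowerDensity_le_openDensity (i : Fin 3) {r : ℝ} (hr : r ∈ Set.Ioc 0 1) :
    lowerDensity naturalMeasure simDim (vertex i)
      ≤ openDensity naturalMeasure simDim (vertex i) r :=
  le_openDensity_of_forall_lt hr.1 fun _ hd =>
    lowerDensity_le_density i ⟨hd.1, hd.2.trans_le hr.2⟩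

/-! ### The radii and the estimates -/

lemma two_zpow_neg_lt_half {k : ℕ} (hk : 1 < k) : (2 : ℝ) ^ (-(k : ℤ)) < 1 / 2 := by
  calc (2 : ℝ) ^ (-(k : ℤ)) < (2 : ℝ) ^ (-1 : ℤ) :=
        zpow_lt_zpow_right₀ one_lt_two (neg_lt_neg (by exact_mod_cast hk))
    _ = 1 / 2 := by rw [zpow_neg_one, one_div]

lemma two_zpow_one_sub (k : ℕ) : (2 : ℝ) ^ (1 - (k : ℤ)) = 2 * (2 : ℝ) ^ (-(k : ℤ)) := by
  rw [sub_eq_add_neg, zpow_add₀ two_ne_zero, zpow_one]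

lemma vertex_mem_approxSet (k : ℕ) (i : Fin 3) : vertex i ∈ approxSet k := by
  rw [approxSet_eq_range]
  exact ⟨fun _ => i, approxCode_const _ i⟩

lemma sim_vertex_mem_approxSet {k : ℕ} (hk : 1 < k) (i j : Fin 3) :
    sim i (vertex j) ∈ approxSet k := by
  obtain ⟨n, rfl⟩ := Nat.exists_eq_add_of_lt hk
  rw [approxSet_eq_range]
  refine ⟨cons i fun _ => j, ?_⟩
  rw [show 1 + n + 1 - 1 = n + 1 by omega, approxCode_succ_cons, approxCode_const]

lemma dist_sim_vertex {i j : Fin 3} (hij : j ≠ i) :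
    dist (sim i (vertex j)) (vertex i) = 1 / 2 := by
  calc dist (sim i (vertex j)) (vertex i) = dist (sim i (vertex j)) (sim i (vertex i)) := by
        rw [sim_vertex i]
    _ = 1 / 2 := by rw [dist_sim, dist_vertex hij, mul_one]

lemma dist_vertex_le_one_of_mem_approxSet {k : ℕ} {x : Plane} (hx : x ∈ approxSet k)
    (i : Fin 3) : dist x (vertex i) ≤ 1 := by
  rw [approxSet_eq_range] at hx
  obtain ⟨w, rfl⟩ := hx
  rw [← code_const i]
  exact dist_code_le_one _ _

lemma finite_radii (k : ℕ) : (radii k).Finite := by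
  refine ((finite_approxSet k).image (dist · (vertex 0))).subset ?_
  rintro d ⟨⟨x, hx, rfl⟩, -⟩
  exact ⟨x, hx, rfl⟩

lemma one_mem_radii (k : ℕ) : 1 ∈ radii k := by
  have hpos : (0 : ℝ) < (2 : ℝ) ^ (-(k : ℤ)) := by positivity
  exact ⟨⟨vertex 1, vertex_mem_approxSet k 1, (dist_vertex (by decide)).symm⟩, by linarith, le_rfl⟩

lemma radii_subset_Ioc {k : ℕ} (hk : 1 < k) : radii k ⊆ Set.Ioc 0 1 := fun _ hd =>
  ⟨by linarith [hd.2.1, two_zpow_neg_lt_half hk], hd.2.2⟩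

lemma isLeast_lowerEstimate (k : ℕ) :
    IsLeast (openDensity (discreteMeasure k) simDim (vertex 0) '' radii k) (lowerEstimate k) :=
  ⟨Set.Nonempty.csInf_mem (.image _ ⟨1, one_mem_radii k⟩) ((finite_radii k).image _),
    fun _ => sInf_le⟩

lemma isGreatest_upperEstimate (k : ℕ) :
    IsGreatest (density (discreteMeasure k) simDim (vertex 0) '' radii k) (upperEstimate k) :=
  ⟨Set.Nonempty.csSup_mem (.image _ ⟨1, one_mem_radii k⟩) ((finite_radii k).image _),
    fun _ => le_sSup⟩

lemma exists_mem_radii_ball_le {k : ℕ} {r : ℝ}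
    (hr : r ∈ Set.Ico (1 / 2 - (2 : ℝ) ^ (-(k : ℤ))) 1) :
    ∃ d ∈ radii k, r < d ∧ discreteMeasure k (Metric.ball (vertex 0) d)
      ≤ discreteMeasure k (Metric.closedBall (vertex 0) r) := by
  have hone : dist (vertex 1) (vertex 0) = 1 := dist_vertex (by decide)
  obtain ⟨y, hyA, hy, hle⟩ := exists_ball_le_closedBall_of_finite (finite_approxSet k)
    (ae_discreteMeasure_mem_approxSet k) (vertex_mem_approxSet k 1) (hone ▸ hr.2)
  exact ⟨_, ⟨⟨y, hyA, rfl⟩, hr.1.trans hy.1.le, hy.2.trans hone.le⟩, hy.1, hle⟩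

lemma exists_mem_radii_closedBall_le {k : ℕ} (hk : 1 < k) {r : ℝ} (hr : 1 / 2 ≤ r) :
    ∃ d ∈ radii k, d ≤ r ∧ discreteMeasure k (Metric.closedBall (vertex 0) r)
      ≤ discreteMeasure k (Metric.closedBall (vertex 0) d) := by
  have hhalf : dist (sim 0 (vertex 1)) (vertex 0) = 1 / 2 := dist_sim_vertex (by decide)
  have hpos : (0 : ℝ) < (2 : ℝ) ^ (-(k : ℤ)) := by positivity
  obtain ⟨y, hyA, hy, hle⟩ := exists_closedBall_le_closedBall_of_finite (finite_approxSet k)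
    (ae_discreteMeasure_mem_approxSet k) (sim_vertex_mem_approxSet hk 0 1) (hhalf ▸ hr)
  refine ⟨_, ⟨⟨y, hyA, rfl⟩, ?_, dist_vertex_le_one_of_mem_approxSet hyA 0⟩, hy.2, hle⟩
  linarith [hy.1]

section Bounds

variable {k : ℕ} (hk : 1 < k)
include hk

lemma mul_lowerEstimate_le_lowerDensity :
    ENNReal.ofReal ((1 - (2 : ℝ) ^ (1 - (k : ℤ))) ^ simDim) * lowerEstimate k
      ≤ lowerDensity naturalMeasure simDim (vertex 0) := by
  have hε := two_zpow_neg_lt_half hk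
  have hε0 : (0 : ℝ) < (2 : ℝ) ^ (-(k : ℤ)) := by positivity
  rw [two_zpow_one_sub]
  refine le_lowerDensity 0 fun d hd => ?_
  obtain ⟨d', hd', hlt, hle⟩ := exists_mem_radii_ball_le (k := k)
    (r := d - (2 : ℝ) ^ (-(k : ℤ))) ⟨by linarith [hd.1], by linarith [hd.2]⟩
  calc _ ≤ ENNReal.ofReal ((1 - 2 * (2 : ℝ) ^ (-(k : ℤ))) ^ simDim) *
        openDensity (discreteMeasure k) simDim (vertex 0) d' := by
        gcongr
        exact (isLeast_lowerEstimate k).2 ⟨d', hd', rfl⟩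
    _ ≤ discreteMeasure k (Metric.ball (vertex 0) d') / ENNReal.ofReal ((2 * d) ^ simDim) :=
        ofReal_rpow_mul_div_le _ simDim_pos.le (by linarith) (by linarith [hd.1])
          (by linarith [(radii_subset_Ioc hk hd').1]) (by nlinarith [hd.1])
    _ ≤ density naturalMeasure simDim (vertex 0) d :=
        ENNReal.div_le_div_right
          (hle.trans (discreteMeasure_closedBall_sub_le k _ _)) _

lemma upperDensity_le_mul_upperEstimate :
    upperDensity naturalMeasure simDim (vertex 0)
      ≤ ENNReal.ofReal ((1 + (2 : ℝ) ^ (1 - (k : ℤ))) ^ simDim) * upperEstimate k := by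
  have hε0 : (0 : ℝ) < (2 : ℝ) ^ (-(k : ℤ)) := by positivity
  rw [two_zpow_one_sub]
  refine upperDensity_le 0 fun d hd => ?_
  obtain ⟨d', hd', hle', hle⟩ := exists_mem_radii_closedBall_le hk
    (r := d + (2 : ℝ) ^ (-(k : ℤ))) (by linarith [hd.1])
  calc density naturalMeasure simDim (vertex 0) d
      ≤ discreteMeasure k (Metric.closedBall (vertex 0) d')
        / ENNReal.ofReal ((2 * d) ^ simDim) :=
        ENNReal.div_le_div_right
          ((naturalMeasure_closedBall_le k _ _).trans hle) _
    _ ≤ ENNReal.ofReal ((1 + 2 * (2 : ℝ) ^ (-(k : ℤ))) ^ simDim) *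
        density (discreteMeasure k) simDim (vertex 0) d' :=
        div_le_ofReal_rpow_mul_div _ simDim_pos.le (by linarith) (by linarith [hd.1])
          (by linarith [(radii_subset_Ioc hk hd').1]) (by nlinarith [hd.1])
    _ ≤ _ := by
        gcongr
        exact (isGreatest_upperEstimate k).2 ⟨d', hd', rfl⟩

lemma mul_lowerEstimate_le_lowerEstimate :
    ENNReal.ofReal ((1 - (2 : ℝ) ^ (1 - (k : ℤ))) ^ simDim) * lowerEstimate k
      ≤ lowerEstimate k := by
  have hε := two_zpow_neg_lt_half hk
  have hε0 : (0 : ℝ) < (2 : ℝ) ^ (-(k : ℤ)) := by positivity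
  rw [two_zpow_one_sub]
  exact mul_le_of_le_one_left' <| ENNReal.ofReal_le_one.2 <|
    Real.rpow_le_one (by linarith) (by linarith) simDim_pos.le

lemma lowerDensity_le_of_mem_radii {d : ℝ} (hd : d ∈ radii k) :
    lowerDensity naturalMeasure simDim (vertex 0)
      ≤ discreteMeasure k (Metric.ball (vertex 0) (d + (2 : ℝ) ^ (-(k : ℤ))))
        / ENNReal.ofReal ((2 * d) ^ simDim) :=
  (lowerDensity_le_openDensity 0 (radii_subset_Ioc hk hd)).trans <|
    ENNReal.div_le_div_right (naturalMeasure_ball_le k _ _) _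

lemma le_upperDensity_of_mem_radii {d : ℝ} (hd : d ∈ radii k) :
    discreteMeasure k (Metric.closedBall (vertex 0) (d - (2 : ℝ) ^ (-(k : ℤ))))
        / ENNReal.ofReal ((2 * d) ^ simDim)
      ≤ upperDensity naturalMeasure simDim (vertex 0) :=
  (ENNReal.div_le_div_right (discreteMeasure_closedBall_sub_le k _ _) _).trans <|
    density_le_upperDensity isInvariant_naturalMeasure.markov_eq 0 (radii_subset_Ioc hk hd).1

end Bounds

lemma upperEstimate_le_mul_upperEstimate (k : ℕ) :
    upperEstimate k
      ≤ ENNReal.ofReal ((1 + (2 : ℝ) ^ (1 - (k : ℤ))) ^ simDim) * upperEstimate k :=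
  le_mul_of_one_le_left' <| ENNReal.one_le_ofReal.2 <|
    Real.one_le_rpow (le_add_of_nonneg_right (by positivity)) simDim_pos.le

lemma openDensity_le_ball_add_div (α : Measure Plane) (t : ℝ) (x : Plane) (d : ℝ) {ε : ℝ}
    (hε : 0 ≤ ε) :
    openDensity α t x d ≤ α (Metric.ball x (d + ε)) / ENNReal.ofReal ((2 * d) ^ t) :=
  ENNReal.div_le_div_right (measure_mono (Metric.ball_subset_ball (le_add_of_nonneg_right hε))) _

lemma closedBall_sub_div_le_density (α : Measure Plane) (t : ℝ) (x : Plane) (d : ℝ) {ε : ℝ}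
    (hε : 0 ≤ ε) :
    α (Metric.closedBall x (d - ε)) / ENNReal.ofReal ((2 * d) ^ t) ≤ density α t x d :=
  ENNReal.div_le_div_right (measure_mono (Metric.closedBall_subset_closedBall (sub_le_self d hε))) _

end SierpinskiGasket

theorem theorem4p5 (k : ℕ) (hk : 1 < k) :
    -- the minimum and the maximum that define the two estimates are attained
    IsLeast (openDensity (discreteMeasure k)
        simDim (vertex 0) '' radii k)
      (lowerEstimate k) ∧
    IsGreatest (density (discreteMeasure k)
        simDim (vertex 0) '' radii k)
      (upperEstimate k) ∧
    -- the lower density and its estimate, for every minimizing radius `d`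
    (∀ d ∈ radii k,
      openDensity (discreteMeasure k)
        simDim (vertex 0) d = lowerEstimate k →
      ({lowerDensity naturalMeasure
          simDim (vertex 0),
        lowerEstimate k} : Set ℝ≥0∞) ⊆
      Set.Icc
        (ENNReal.ofReal ((1 - (2 : ℝ) ^ (1 - (k : ℤ))) ^ simDim) *
          lowerEstimate k)
        (discreteMeasure k
            (Metric.ball (vertex 0) (d + (2 : ℝ) ^ (-(k : ℤ)))) /
          ENNReal.ofReal ((2 * d) ^ simDim))) ∧
    -- the upper density and its estimate, for every maximizing radius `D`
    (∀ D ∈ radii k,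
      density (discreteMeasure k)
        simDim (vertex 0) D = upperEstimate k →
      ({upperDensity naturalMeasure
          simDim (vertex 0),
        upperEstimate k} : Set ℝ≥0∞) ⊆
      Set.Icc
        (discreteMeasure k
            (Metric.closedBall (vertex 0) (D - (2 : ℝ) ^ (-(k : ℤ)))) /
          ENNReal.ofReal ((2 * D) ^ simDim))
        (ENNReal.ofReal ((1 + (2 : ℝ) ^ (1 - (k : ℤ))) ^ simDim) *
          upperEstimate k)) := by
  have hε : (0 : ℝ) ≤ (2 : ℝ) ^ (-(k : ℤ)) := by positivity
  refine ⟨isLeast_lowerEstimate k, isGreatest_upperEstimate k, fun d hd hmin => ?_,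
    fun D hD hmax => ?_⟩
  · refine Set.pair_subset
      ⟨mul_lowerEstimate_le_lowerDensity hk, lowerDensity_le_of_mem_radii hk hd⟩
      ⟨mul_lowerEstimate_le_lowerEstimate hk, ?_⟩
    exact hmin ▸ openDensity_le_ball_add_div _ simDim _ d hε
  · refine Set.pair_subset
      ⟨le_upperDensity_of_mem_radii hk hD, upperDensity_le_mul_upperEstimate hk⟩
      ⟨?_, upperEstimate_le_mul_upperEstimate k⟩
    exact hmax ▸ closedBall_sub_div_le_density _ simDim _ D hε
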